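/- **Setting.** Let $L\ge 1$, $T\ge L$, $m,p\ge 0$ be integers, $q=m+p$, $n=T-L+1$. Consider AR systems $$y(t+L)+P_{L-1}y(t+L-1)+\dots+P_0y(t)=Q_{L-1}u(t+L-1)+\dots+Q_0u(t)+v(t),\qquad t\in\mathbb Z_+,$$ with $u(t)\in\mathbb R^m$, $y(t),v(t)\in\mathbb R^p$ and coefficient matrix $R=\begin{bmatrix}-Q_0&P_0&\cdots&-Q_{L-1}&P_{L-1}\end{bmatrix}\in\mathbb R^{p\times qL}$, and controllers $$u(t+L)+G_{L-1}u(t+L-1)+\dots+G_0u(t)=F_{L-1}y(t+L-1)+\dots+F_0y(t)$$ with coefficient matrix $C=\begin{bmatrix}G_0&-F_0&\cdots&G_{L-1}&-F_{L-1}\end{bmatrix}\in\mathbb R^{m\times qL}$. Write $w=\mathrm{col}(u,y)$. Let $\Pi=\begin{bmatrix}\Pi_{11}&\Pi_{12}\\ \Pi_{21}&\Pi_{22}\end{bmatrix}$ be a given symmetric $(p+n)\times(p+n)$ matrix with $\Pi_{22}<0$ and $\Pi_{11}-\Pi_{12}\Pi_{22}^{-1}\Pi_{21}\ge0$; a matrix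 $V\in\mathbb R^{p\times n}$ is called admissible if $\begin{bmatrix}I\\V^\top\end{bmatrix}^\top\Pi\begin{bmatrix}I\\V^\top\end{bmatrix}\ge0$. The data $u(0),\dots,u(T),y(0),\dots,y(T)$ are assumed to be samples on $[0,T]$ of a solution of some (unknown) system of the above form, with noise such that $\begin{bmatrix}v(0)&\cdots&v(T-L)\end{bmatrix}$ is admissible. Put $$H'_1(w)=\begin{bmatrix}w(0)&\cdots&w(T-L)\\ \vdots&&\vdots\\ w(L-1)&\cdots&w(T-1)\end{bmatrix},\quad H'_2(w)=\begin{bmatrix}y(L)&\cdots&y(T)\end{bmatrix},\quad N=\begin{bmatrix}I&H'_2(w)\\0&H'_1(w)\end{bmatrix}\Pi\begin{bmatrix}I&H'_2(w)\\0&H'_1(w)\end{bmatrix}^\top,$$ $$\bar N=\begin{bmatrix}\begin{bmatrix}0&0&I_p\end{bmatrix}&0\\0&I_{qL}\end{bmatrix}^\top N\begin{bmatrix}\begin{bmatrix}0&0&I_p\end{bmatrix}&0\\0&I_{qL}\end{bmatrix},\qquad J=\begin{bmatrix}0_{q(L-1)\times q}&I_{q(L-1)}\end{bmatrix},$$ where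 $\begin{bmatrix}0&0&I_p\end{bmatrix}\in\mathbb R^{p\times qL}$. A system with coefficient matrix $R$ is *compatible with the data* if $RH'_1(w)+H'_2(w)$ is admissible; equivalently $\begin{bmatrix}I\\R^\top\end{bmatrix}^\top N\begin{bmatrix}I\\R^\top\end{bmatrix}\ge0$. The data are *informative for quadratic stabilization* if there exist $C\in\mathbb R^{m\times qL}$ and a symmetric $\Psi\in\mathbb R^{qL\times qL}$, $\Psi\ge0$, such that $$\begin{bmatrix}I_{qL}\\-C\\-R\end{bmatrix}^\top\left(\begin{bmatrix}0_q&0\\0&\Psi\end{bmatrix}-\begin{bmatrix}\Psi&0\\0&0_q\end{bmatrix}\right)\begin{bmatrix}I_{qL}\\-C\\-R\end{bmatrix}<0$$ for all $R\in\mathbb R^{p\times qL}$ with $\begin{bmatrix}I\\R^\top\end{bmatrix}^\top N\begin{bmatrix}I\\R^\top\end{bmatrix}\ge0$. **Theorem.** Assume that $H'_1(w)$ has full row rank. Then the data are informative for quadratic stabilization if and only if there exist $D\in\mathbb R^{m\times qL}$ and a symmetric $\Phi\in\mathbb R^{qL\times qL}$ such that $\Phi>0$ and $$\begin{bmatrix}\Phi&X&X\\X^\top&-\Phi&0\\X^\top&0&\Phi\end{bmatrix}-\begin{bmatrix}\bar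 N&0\\0&0_{qL}\end{bmatrix}>0,\qquad X=\begin{bmatrix}J\Phi\\D\\0\end{bmatrix}.\tag{LMI}$$ In that case, for all such $\Phi,D$, the controller with coefficient matrix $C=-D\Phi^{-1}$ stabilizes every system compatible with the data: for $v=0$, all solutions $(u,y)$ on $\mathbb Z_+$ of the closed loop tend to $0$ as $t\to\infty$. Moreover, with $\Psi=\Phi^{-1}$, the quadratic difference form $$Q_\Psi(w)(t)=\begin{bmatrix}w(t)\\ \vdots\\ w(t+L-1)\end{bmatrix}^\top\Psi\begin{bmatrix}w(t)\\ \vdots\\ w(t+L-1)\end{bmatrix}$$ is a common Lyapunov function for all these closed loops: for every closed-loop solution $w$ with $v=0$, $Q_\Psi(w)(t)\ge0$ and $Q_{\nabla\Psi}(w)(t):=Q_\Psi(w)(t+1)-Q_\Psi(w)(t)\le0$ for all $t$, and $Q_{\nabla\Psi}(w)$ vanishes identically if and only if $w=0$. -/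

import Mathlib

open Matrix

/-! Input-output autoregressive (AR) systems of order `L` with `m` inputs and `p` outputs.
The manifest variable `w = col(u, y)` takes values in `ℝ^q`, `q = m + p`, indexed by
`Fin m ⊕ Fin p`; the space `ℝ^(qL)` is indexed by `Fin L × (Fin m ⊕ Fin p)` (first the time
lag, then the component), so that `(k, c)` is the `c`-th entry of the `k`-th block of size `q`. -/

/-- Index set of the components of `w = col(u, y)`. -/
abbrev WIdx (m p : ℕ) : Type := Fin m ⊕ Fin p

/-- Index set of `ℝ^(qL)`. -/
abbrev LIdx (m p L : ℕ) : Type := Fin L × WIdx m p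

/-- A system `P(σ) y = Q(σ) u + v` with `P(ξ) = I ξ^L + P_{L-1} ξ^{L-1} + ⋯ + P_0` and
`Q(ξ) = Q_{L-1} ξ^{L-1} + ⋯ + Q_0`, given by its coefficient matrices. -/
structure IOSystem (m p L : ℕ) where
  P : Fin L → Matrix (Fin p) (Fin p) ℝ
  Q : Fin L → Matrix (Fin p) (Fin m) ℝ

/-- A feedback controller `G(σ) u = F(σ) y` with `G(ξ) = I ξ^L + G_{L-1} ξ^{L-1} + ⋯ + G_0` and
`F(ξ) = F_{L-1} ξ^{L-1} + ⋯ + F_0`, given by its coefficient matrices. -/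
structure FBController (m p L : ℕ) where
  G : Fin L → Matrix (Fin m) (Fin m) ℝ
  F : Fin L → Matrix (Fin m) (Fin p) ℝ

namespace IOSystem

variable {m p L : ℕ}

/-- The signals `u, y, v` on `ℤ₊` satisfy `P(σ) y = Q(σ) u + v`. -/
def Satisfies (S : IOSystem m p L) (u : ℕ → Fin m → ℝ) (y v : ℕ → Fin p → ℝ) : Prop :=
  ∀ t : ℕ, y (t + L) + ∑ i : Fin L, S.P i *ᵥ y (t + i) = ∑ i : Fin L, S.Q i *ᵥ u (t + i) + v t

/-- The coefficient matrix `R = [-Q_0  P_0  -Q_1  P_1  ⋯  -Q_{L-1}  P_{L-1}]`. -/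
def coeff (S : IOSystem m p L) : Matrix (Fin p) (LIdx m p L) ℝ :=
  Matrix.of fun a j => Sum.elim (fun b => - S.Q j.1 a b) (fun b => S.P j.1 a b) j.2

end IOSystem

namespace FBController

variable {m p L : ℕ}

/-- The signals `u, y` on `ℤ₊` satisfy `G(σ) u = F(σ) y`. -/
def Satisfies (K : FBController m p L) (u : ℕ → Fin m → ℝ) (y : ℕ → Fin p → ℝ) : Prop :=
  ∀ t : ℕ, u (t + L) + ∑ i : Fin L, K.G i *ᵥ u (t + i) = ∑ i : Fin L, K.F i *ᵥ y (t + i)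

/-- The coefficient matrix `C = [G_0  -F_0  G_1  -F_1  ⋯  G_{L-1}  -F_{L-1}]`. -/
def coeff (K : FBController m p L) : Matrix (Fin m) (LIdx m p L) ℝ :=
  Matrix.of fun a j => Sum.elim (fun b => K.G j.1 a b) (fun b => - K.F j.1 a b) j.2

/-- The controller with a given coefficient matrix. -/
def ofCoeff (C : Matrix (Fin m) (LIdx m p L) ℝ) : FBController m p L where
  G i := Matrix.of fun a b => C a (i, Sum.inl b)
  F i := Matrix.of fun a b => - C a (i, Sum.inr b)

theorem coeff_ofCoeff (C : Matrix (Fin m) (LIdx m p L) ℝ) : (ofCoeff C).coeff = C := by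
  ext a ⟨i, c⟩
  cases c <;> simp [coeff, ofCoeff]

end FBController

/-- The closed loop with zero noise: all `w = col(u, y)` on `ℤ₊` with `P(σ) y = Q(σ) u` and
`G(σ) u = F(σ) y`. -/
def closedLoop {m p L : ℕ} (S : IOSystem m p L) (K : FBController m p L) :
    Set (ℕ → WIdx m p → ℝ) :=
  {w | S.Satisfies (fun t a => w t (Sum.inl a)) (fun t b => w t (Sum.inr b)) 0 ∧
    K.Satisfies (fun t a => w t (Sum.inl a)) (fun t b => w t (Sum.inr b))}

/-- A behavior is stable if all its trajectories tend to zero. -/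
def IsStableBehavior {ι : Type} (B : Set (ℕ → ι → ℝ)) : Prop :=
  ∀ w ∈ B, Filter.Tendsto w Filter.atTop (nhds 0)

/-! Quadratic difference forms. -/

section QDF

variable {ι : Type} [Fintype ι] {n : ℕ}

/-- `Q_Φ(w)(t) = ∑_{k,l} w(t+k)ᵀ Φ_{k,l} w(t+l)`. -/
def QDF (Φ : Matrix (Fin n × ι) (Fin n × ι) ℝ) (w : ℕ → ι → ℝ) (t : ℕ) : ℝ :=
  ∑ k : Fin n, ∑ l : Fin n,
    w (t + k) ⬝ᵥ ((Matrix.of fun a b => Φ (k, a) (l, b)) *ᵥ w (t + l))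

/-- `∇Φ = diag(0_q, Φ) - diag(Φ, 0_q)`. -/
def nablaMat {ι : Type} {n : ℕ} (Φ : Matrix (Fin n × ι) (Fin n × ι) ℝ) :
    Matrix (Fin (n + 1) × ι) (Fin (n + 1) × ι) ℝ :=
  (Matrix.of fun x y =>
    Fin.cases 0 (fun i => Fin.cases 0 (fun j => Φ (i, x.2) (j, y.2)) y.1) x.1) -
  (Matrix.of fun x y =>
    Fin.lastCases 0 (fun i => Fin.lastCases 0 (fun j => Φ (i, x.2) (j, y.2)) y.1) x.1)

/-- `Q_Φ ≥ 0` on the behavior `B`. -/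
def QDFNonnegOn (Φ : Matrix (Fin n × ι) (Fin n × ι) ℝ) (B : Set (ℕ → ι → ℝ)) : Prop :=
  ∀ w ∈ B, ∀ t, 0 ≤ QDF Φ w t

/-- `Q_Φ < 0` on the behavior `B`: `Q_Φ(w) ≤ 0` for all `w ∈ B`, and `Q_Φ(w)` is the zero
function only for `w = 0`. -/
def QDFNegOn (Φ : Matrix (Fin n × ι) (Fin n × ι) ℝ) (B : Set (ℕ → ι → ℝ)) : Prop :=
  ∀ w ∈ B, (∀ t, QDF Φ w t ≤ 0) ∧ ((∀ t, QDF Φ w t = 0) ↔ w = 0)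

/-- `Q_Ψ` (`Ψ` symmetric) is a Lyapunov function for the behavior `B`. -/
def IsLyapunovQDF (Ψ : Matrix (Fin n × ι) (Fin n × ι) ℝ) (B : Set (ℕ → ι → ℝ)) : Prop :=
  Ψ.IsSymm ∧ QDFNonnegOn Ψ B ∧ QDFNegOn (nablaMat Ψ) B

end QDF

/-! Noise model and data. -/

/-- `[I; Z]ᵀ Π [I; Z]`. -/
noncomputable def qmiMat {ι κ : Type} [Fintype ι] [DecidableEq ι] [Fintype κ]
    (Pi : Matrix (ι ⊕ κ) (ι ⊕ κ) ℝ) (Z : Matrix κ ι ℝ) : Matrix ι ι ℝ :=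
  let E : Matrix (ι ⊕ κ) ι ℝ := Matrix.fromRows 1 Z
  Eᵀ * Pi * E

/-- The noise samples collected in `V` satisfy `[I; Vᵀ]ᵀ Π [I; Vᵀ] ≥ 0`. -/
def NoiseQMI {p n : ℕ} (Pi : Matrix (Fin p ⊕ Fin n) (Fin p ⊕ Fin n) ℝ)
    (V : Matrix (Fin p) (Fin n) ℝ) : Prop :=
  (qmiMat Pi Vᵀ).PosSemidef

/-- Standing assumption on the known matrix `Π`: it is symmetric, `Π₂₂ < 0` and the Schur
complement `Π₁₁ - Π₁₂ Π₂₂⁻¹ Π₂₁` is positive semidefinite. -/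
structure IsNoiseModel {p n : ℕ} (Pi : Matrix (Fin p ⊕ Fin n) (Fin p ⊕ Fin n) ℝ) : Prop where
  symm : Pi.IsSymm
  neg : (- Pi.toBlocks₂₂).PosDef
  schur : (Pi.toBlocks₁₁ - Pi.toBlocks₁₂ * Pi.toBlocks₂₂⁻¹ * Pi.toBlocks₂₁).PosSemidef

section Data

variable {m p L T : ℕ}

/-- The data `u(0), …, u(T), y(0), …, y(T)` are samples on `[0, T]` of signals `u', y'` that are
generated by some (true) system of the model class with a noise signal `v` whose samples
`v(0), …, v(T - L)` satisfy the noise QMI. -/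
def GeneratedData (L : ℕ) (Pi : Matrix (Fin p ⊕ Fin (T - L + 1)) (Fin p ⊕ Fin (T - L + 1)) ℝ)
    (u : Fin (T + 1) → Fin m → ℝ) (y : Fin (T + 1) → Fin p → ℝ) : Prop :=
  ∃ (S : IOSystem m p L) (u' : ℕ → Fin m → ℝ) (y' v : ℕ → Fin p → ℝ),
    S.Satisfies u' y' v ∧ (∀ t : Fin (T + 1), u' t = u t ∧ y' t = y t) ∧
    NoiseQMI Pi (Matrix.of fun a (t : Fin (T - L + 1)) => v t a)

/-- The Hankel matrix `H'₁(w)` of depth `L`: its block in row `k` and column `t` is `w(t + k)`,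
for `0 ≤ k ≤ L - 1` and `0 ≤ t ≤ T - L`. -/
def hankel1 (hLT : L ≤ T) (u : Fin (T + 1) → Fin m → ℝ) (y : Fin (T + 1) → Fin p → ℝ) :
    Matrix (LIdx m p L) (Fin (T - L + 1)) ℝ :=
  Matrix.of fun j t =>
    Sum.elim (u ⟨t + j.1, by omega⟩) (y ⟨t + j.1, by omega⟩) j.2

/-- `H'₂(w) = [y(L)  y(L+1)  ⋯  y(T)]`. -/
def hankel2 (hLT : L ≤ T) (y : Fin (T + 1) → Fin p → ℝ) :
    Matrix (Fin p) (Fin (T - L + 1)) ℝ :=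
  Matrix.of fun a t => y ⟨t + L, by omega⟩ a

/-- The system `S` is compatible with the data: `[R  I] [H'₁(w); H'₂(w)] = V` for some `V`
that satisfies the noise QMI. -/
def Compatible (hLT : L ≤ T)
    (Pi : Matrix (Fin p ⊕ Fin (T - L + 1)) (Fin p ⊕ Fin (T - L + 1)) ℝ)
    (u : Fin (T + 1) → Fin m → ℝ) (y : Fin (T + 1) → Fin p → ℝ) (S : IOSystem m p L) : Prop :=
  ∃ V : Matrix (Fin p) (Fin (T - L + 1)) ℝ, NoiseQMI Pi V ∧
    Matrix.fromCols S.coeff (1 : Matrix (Fin p) (Fin p) ℝ) *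
      Matrix.fromRows (hankel1 hLT u y) (hankel2 hLT y) = V

/-- `N = [I  H'₂(w); 0  H'₁(w)] Π [I  H'₂(w); 0  H'₁(w)]ᵀ`. -/
noncomputable def dataN (hLT : L ≤ T)
    (Pi : Matrix (Fin p ⊕ Fin (T - L + 1)) (Fin p ⊕ Fin (T - L + 1)) ℝ)
    (u : Fin (T + 1) → Fin m → ℝ) (y : Fin (T + 1) → Fin p → ℝ) :
    Matrix (Fin p ⊕ LIdx m p L) (Fin p ⊕ LIdx m p L) ℝ :=
  let E : Matrix (Fin p ⊕ LIdx m p L) (Fin p ⊕ Fin (T - L + 1)) ℝ :=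
    Matrix.fromBlocks 1 (hankel2 hLT y) 0 (hankel1 hLT u y)
  E * Pi * Eᵀ

/-- The QMI `[I; Rᵀ]ᵀ N [I; Rᵀ] ≥ 0`. -/
def DataQMI (N : Matrix (Fin p ⊕ LIdx m p L) (Fin p ⊕ LIdx m p L) ℝ)
    (R : Matrix (Fin p) (LIdx m p L) ℝ) : Prop :=
  (qmiMat N Rᵀ).PosSemidef

/-- The matrix `[I_{qL}; -C; -R]`. -/
def closedLoopMat (C : Matrix (Fin m) (LIdx m p L) ℝ) (R : Matrix (Fin p) (LIdx m p L) ℝ) :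
    Matrix (Fin (L + 1) × WIdx m p) (LIdx m p L) ℝ :=
  Matrix.of fun x j =>
    Fin.lastCases (Sum.elim (fun a => - C a j) (fun b => - R b j) x.2)
      (fun k => (1 : Matrix (LIdx m p L) (LIdx m p L) ℝ) (k, x.2) j) x.1

/-- The QMI `[I; -C; -R]ᵀ (diag(0_q, Ψ) - diag(Ψ, 0_q)) [I; -C; -R] < 0`. -/
def LyapunovQMI (Ψ : Matrix (LIdx m p L) (LIdx m p L) ℝ) (C : Matrix (Fin m) (LIdx m p L) ℝ)
    (R : Matrix (Fin p) (LIdx m p L) ℝ) : Prop :=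
  (- ((closedLoopMat C R)ᵀ * nablaMat Ψ * closedLoopMat C R)).PosDef

/-- The data are informative for quadratic stabilization. -/
def InformativeForQuadraticStabilization (hLT : L ≤ T)
    (Pi : Matrix (Fin p ⊕ Fin (T - L + 1)) (Fin p ⊕ Fin (T - L + 1)) ℝ)
    (u : Fin (T + 1) → Fin m → ℝ) (y : Fin (T + 1) → Fin p → ℝ) : Prop :=
  ∃ (C : Matrix (Fin m) (LIdx m p L) ℝ) (Ψ : Matrix (LIdx m p L) (LIdx m p L) ℝ),
    Ψ.PosSemidef ∧
    ∀ R : Matrix (Fin p) (LIdx m p L) ℝ, DataQMI (dataN hLT Pi u y) R → LyapunovQMI Ψ C R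

/-- The `p × qL` matrix `[0  0  I_p]`. -/
def selLast (m p L : ℕ) : Matrix (Fin p) (LIdx m p L) ℝ :=
  Matrix.of fun a j => if (j.1 : ℕ) + 1 = L ∧ j.2 = Sum.inr a then 1 else 0

/-- `N̄ = diag([0  0  I_p], I_{qL})ᵀ N diag([0  0  I_p], I_{qL})`. -/
noncomputable def dataNbar (hLT : L ≤ T)
    (Pi : Matrix (Fin p ⊕ Fin (T - L + 1)) (Fin p ⊕ Fin (T - L + 1)) ℝ)
    (u : Fin (T + 1) → Fin m → ℝ) (y : Fin (T + 1) → Fin p → ℝ) :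
    Matrix (LIdx m p L ⊕ LIdx m p L) (LIdx m p L ⊕ LIdx m p L) ℝ :=
  let E : Matrix (Fin p ⊕ LIdx m p L) (LIdx m p L ⊕ LIdx m p L) ℝ :=
    Matrix.fromBlocks (selLast m p L) 0 0 1
  Eᵀ * dataN hLT Pi u y * E

/-- The `q(L-1) × qL` matrix `J = [0  I_{q(L-1)}]`. -/
def shiftJ (m p L : ℕ) : Matrix (LIdx m p (L - 1)) (LIdx m p L) ℝ :=
  Matrix.of fun x j => if (j.1 : ℕ) = x.1 + 1 ∧ j.2 = x.2 then 1 else 0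

/-- The `qL × qL` matrix `[J Φ; D; 0]`, whose last block row of height `q = m + p` is `[D; 0]`. -/
noncomputable def stackJD (Φ : Matrix (LIdx m p L) (LIdx m p L) ℝ)
    (D : Matrix (Fin m) (LIdx m p L) ℝ) : Matrix (LIdx m p L) (LIdx m p L) ℝ :=
  Matrix.of fun x j =>
    if h : (x.1 : ℕ) < L - 1 then (shiftJ m p L * Φ) (⟨x.1, h⟩, x.2) j
    else Sum.elim (fun a => D a j) (fun _ => 0) x.2

/-- The LMI
`[Φ X X; Xᵀ -Φ 0; Xᵀ 0 Φ] - diag(N̄, 0_{qL}) > 0` with `X = [J Φ; D; 0]`. -/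
def StabilizationLMI
    (Nbar : Matrix (LIdx m p L ⊕ LIdx m p L) (LIdx m p L ⊕ LIdx m p L) ℝ)
    (Φ : Matrix (LIdx m p L) (LIdx m p L) ℝ) (D : Matrix (Fin m) (LIdx m p L) ℝ) : Prop :=
  (Matrix.fromBlocks
      (Matrix.fromBlocks Φ (stackJD Φ D) (stackJD Φ D)ᵀ (-Φ))
      (Matrix.fromRows (stackJD Φ D) 0)
      (Matrix.fromCols (stackJD Φ D)ᵀ 0)
      Φ
    - Matrix.fromBlocks Nbar 0 0 0).PosDef

end Data

/-! Along a closed loop the windows of length L evolve by the companion matrix A = `stateMat C R`,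
and the inequality in the definition of informativity is the Lyapunov inequality Ψ - AᵀΨA > 0
(`lyapunovQMI_iff`). With Φ = Ψ⁻¹ it dualizes to Φ - AΦAᵀ > 0 (`posDef_sub_conj_inv_iff`). Since A
is affine in R and D = -CΦ absorbs the controller, this is a quadratic inequality in Rᵀ with matrix
`schurMat Φ X`, of the same kind as the one the data impose on R. A Schur complement turns the LMI
into `schurMat Φ X` - N̄ > 0 (`stabilizationLMI_iff`).

Sufficiency: evaluate this at (x, RᵀEx) with E = `selLast`; the N̄ term is nonnegative for every R
allowed by the data. Stability and the Lyapunov property then follow from the dynamics of A.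

Necessity: full row rank makes the lower right block of N negative definite. Then every pair (a, z)
with nonnegative N-form satisfies z = Rᵀa for some R allowed by the data
(`exists_mulVec_eq_and_qmi`), so the quantifier over R becomes an implication between two quadratic
forms. `strict_s_lemma` yields `schurMat Φ X` - αN̄ > 0, the negative definite block forces α > 0,
and dividing Φ and D by α gives the LMI. -/

/-! ### Quadratic forms, compactness and the S-lemma -/

section QuadraticForms

variable {ι κ : Type} [Fintype ι] [Fintype κ]

/-- The quadratic form `xᵀ M x`. -/
def quadForm (M : Matrix ι ι ℝ) (x : ι → ℝ) : ℝ := x ⬝ᵥ (M *ᵥ x)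

theorem quadForm_conj (E : Matrix ι κ ℝ) (M : Matrix ι ι ℝ) (x : κ → ℝ) :
    quadForm (Eᵀ * M * E) x = quadForm M (E *ᵥ x) := by
  simp only [quadForm, ← mulVec_mulVec]
  rw [dotProduct_mulVec, vecMul_transpose]

theorem quadForm_sub (M N : Matrix ι ι ℝ) (x : ι → ℝ) :
    quadForm (M - N) x = quadForm M x - quadForm N x := by
  simp [quadForm, sub_mulVec, dotProduct_sub]

theorem quadForm_neg (M : Matrix ι ι ℝ) (x : ι → ℝ) :
    quadForm (-M) x = - quadForm M x := by
  simp [quadForm, neg_mulVec]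

theorem quadForm_smul_left (c : ℝ) (M : Matrix ι ι ℝ) (x : ι → ℝ) :
    quadForm (c • M) x = c * quadForm M x := by
  simp [quadForm, smul_mulVec]

theorem quadForm_smul (c : ℝ) (M : Matrix ι ι ℝ) (x : ι → ℝ) :
    quadForm M (c • x) = c ^ 2 * quadForm M x := by
  simp only [quadForm, mulVec_smul, dotProduct_smul, smul_dotProduct, smul_eq_mul]
  ring

@[simp]
theorem quadForm_zero (M : Matrix ι ι ℝ) : quadForm M 0 = 0 := by simp [quadForm]

theorem quadForm_add_smul (M : Matrix ι ι ℝ) (x y : ι → ℝ) (s : ℝ) :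
    quadForm M (x + s • y) =
      quadForm M x + s * (x ⬝ᵥ (M *ᵥ y) + y ⬝ᵥ (M *ᵥ x)) + s ^ 2 * quadForm M y := by
  simp only [quadForm, mulVec_add, mulVec_smul, dotProduct_add, add_dotProduct, dotProduct_smul,
    smul_dotProduct, smul_eq_mul]
  ring

theorem continuous_quadForm (M : Matrix ι ι ℝ) : Continuous (quadForm M) := by
  unfold quadForm
  fun_prop

theorem posDef_iff_quadForm {M : Matrix ι ι ℝ} :
    M.PosDef ↔ M.IsSymm ∧ ∀ x, x ≠ 0 → 0 < quadForm M x := by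
  rw [posDef_iff_dotProduct_mulVec]
  simp [quadForm, IsHermitian, IsSymm]

theorem posSemidef_iff_quadForm {M : Matrix ι ι ℝ} :
    M.PosSemidef ↔ M.IsSymm ∧ ∀ x, 0 ≤ quadForm M x := by
  rw [posSemidef_iff_dotProduct_mulVec]
  simp [quadForm, IsHermitian, IsSymm]

omit [Fintype κ] in
theorem isSymm_conj (E : Matrix ι κ ℝ) {M : Matrix ι ι ℝ} (hM : M.IsSymm) :
    (Eᵀ * M * E).IsSymm := by
  simp [IsSymm, transpose_mul, hM.eq, Matrix.mul_assoc]

theorem quadForm_qmiMat [DecidableEq ι] (N : Matrix (ι ⊕ κ) (ι ⊕ κ) ℝ) (Z : Matrix κ ι ℝ)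
    (x : ι → ℝ) : quadForm (qmiMat N Z) x = quadForm N (Sum.elim x (Z *ᵥ x)) := by
  simp [qmiMat, quadForm_conj, fromRows_mulVec]

theorem qmiMat_posSemidef_iff [DecidableEq ι] {N : Matrix (ι ⊕ κ) (ι ⊕ κ) ℝ} (hN : N.IsSymm)
    {Z : Matrix κ ι ℝ} :
    (qmiMat N Z).PosSemidef ↔ ∀ x, 0 ≤ quadForm N (Sum.elim x (Z *ᵥ x)) := by
  simp only [posSemidef_iff_quadForm, quadForm_qmiMat]
  exact and_iff_right (isSymm_conj _ hN)

/-! Compactness of the unit sphere. -/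

theorem isCompact_dotProduct_self_eq_one : IsCompact {x : ι → ℝ | x ⬝ᵥ x = 1} := by
  refine Metric.isCompact_of_isClosed_isBounded
    (isClosed_eq (by fun_prop) continuous_const) ?_
  refine (Metric.isBounded_closedBall (x := (0 : ι → ℝ)) (r := 1)).subset fun x hx => ?_
  rw [mem_closedBall_zero_iff, pi_norm_le_iff_of_nonneg zero_le_one]
  intro i
  have h : x i * x i ≤ x ⬝ᵥ x :=
    Finset.single_le_sum (f := fun i => x i * x i) (fun i _ => mul_self_nonneg _)
      (Finset.mem_univ i)
  rw [hx] at h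
  rw [Real.norm_eq_abs]
  exact abs_le_one_iff_mul_self_le_one.mpr h

theorem exists_pos_smul_dotProduct_self_eq_one {x : ι → ℝ} (hx : x ≠ 0) :
    ∃ c : ℝ, 0 < c ∧ (c • x) ⬝ᵥ (c • x) = 1 := by
  have h : 0 < x ⬝ᵥ x := by
    simpa using Matrix.dotProduct_star_self_pos_iff.mpr hx
  refine ⟨(√(x ⬝ᵥ x))⁻¹, by positivity, ?_⟩
  have h2 := Real.mul_self_sqrt h.le
  have h3 : √(x ⬝ᵥ x) ≠ 0 := by positivity
  simp only [smul_dotProduct, dotProduct_smul, smul_eq_mul]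
  field_simp
  nlinarith

/-- A quadratic form that is positive on the nonzero elements of a closed cone dominates a
positive multiple of the squared norm there. -/
theorem exists_pos_mul_le_quadForm {M : Matrix ι ι ℝ} {s : Set (ι → ℝ)} (hs : IsClosed s)
    (hcone : ∀ x ∈ s, ∀ c : ℝ, 0 < c → c • x ∈ s) (h : ∀ x ∈ s, x ≠ 0 → 0 < quadForm M x) :
    ∃ ε : ℝ, 0 < ε ∧ ∀ x ∈ s, ε * (x ⬝ᵥ x) ≤ quadForm M x := by
  have hK : IsCompact ({x : ι → ℝ | x ⬝ᵥ x = 1} ∩ s) :=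
    isCompact_dotProduct_self_eq_one.inter_right hs
  rcases Set.eq_empty_or_nonempty ({x : ι → ℝ | x ⬝ᵥ x = 1} ∩ s) with he | hne
  · refine ⟨1, one_pos, fun x hx => ?_⟩
    rcases eq_or_ne x 0 with rfl | hx0
    · simp
    · obtain ⟨c, hc, hc1⟩ := exists_pos_smul_dotProduct_self_eq_one hx0
      exact (Set.eq_empty_iff_forall_notMem.mp he (c • x) ⟨hc1, hcone x hx c hc⟩).elim
  · obtain ⟨z, hz, hmin⟩ := hK.exists_isMinOn hne (continuous_quadForm M).continuousOn
    have hz0 : z ≠ 0 := by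
      rintro rfl
      simpa using hz.1
    refine ⟨quadForm M z, h z hz.2 hz0, fun x hx => ?_⟩
    rcases eq_or_ne x 0 with rfl | hx0
    · simp
    · obtain ⟨c, hc, hc1⟩ := exists_pos_smul_dotProduct_self_eq_one hx0
      have h1 : quadForm M z ≤ quadForm M (c • x) := hmin ⟨hc1, hcone x hx c hc⟩
      rw [quadForm_smul] at h1
      simp only [smul_dotProduct, dotProduct_smul, smul_eq_mul] at hc1
      have h2 : 0 < c ^ 2 := by positivity
      refine le_of_mul_le_mul_left ?_ h2
      calc c ^ 2 * (quadForm M z * (x ⬝ᵥ x)) = quadForm M z * (c * (c * (x ⬝ᵥ x))) := by ring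
        _ ≤ _ := by rw [hc1, mul_one]; exact h1

/-! The strict S-lemma. -/

/-- The line x + s y meets the cone N = 0 at parameters of opposite signs, and M is positive at both
points; a positive combination of the two values eliminates the mixed term of M. In the S-lemma this
separates the ratios M/N on N < 0 from those on N > 0. -/
theorem quadForm_mul_lt_of_neg_of_pos {M N : Matrix ι ι ℝ}
    (h : ∀ x, x ≠ 0 → 0 ≤ quadForm N x → 0 < quadForm M x) {x y : ι → ℝ}
    (hx : 0 < quadForm N x) (hy : quadForm N y < 0) :
    quadForm N y * quadForm M x < quadForm N x * quadForm M y := by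
  set a := quadForm N y
  set c := quadForm N x
  set b := x ⬝ᵥ (N *ᵥ y) + y ⬝ᵥ (N *ᵥ x) with hb
  set r := √(b ^ 2 - 4 * a * c)
  have hac : a * c < 0 := mul_neg_of_neg_of_pos hy hx
  have hr2 : r ^ 2 = b ^ 2 - 4 * a * c := Real.sq_sqrt (by nlinarith [sq_nonneg b])
  have hbr : |b| < r := by
    refine Real.lt_sqrt_of_sq_lt ?_
    rw [sq_abs]
    linarith
  obtain ⟨hbr1, hbr2⟩ := abs_lt.mp hbr
  have ha : a ≠ 0 := hy.ne
  have hroot : ∀ e : ℝ, e ^ 2 = r ^ 2 →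
      0 < quadForm M (x + ((-b + e) / (2 * a)) • y) := by
    intro e he
    have hzero : quadForm N (x + ((-b + e) / (2 * a)) • y) = 0 := by
      rw [quadForm_add_smul]
      change c + _ * b + _ * a = 0
      field_simp
      linear_combination he + hr2
    -- If the point were zero, x would be a multiple of y and N would not be positive at x.
    refine h _ (fun h0 => ?_) hzero.ge
    have hxy : x = (-((-b + e) / (2 * a))) • y := by
      rw [neg_smul]
      exact eq_neg_of_add_eq_zero_left h0
    have : c = _ := congrArg (quadForm N) hxy
    rw [quadForm_smul] at this
    change c = _ * a at this
    nlinarith [sq_nonneg (-((-b + e) / (2 * a)))]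
  have h1 := hroot (-r) (by ring)
  have h2 := hroot r rfl
  rw [quadForm_add_smul] at h1 h2
  set β := x ⬝ᵥ (M *ᵥ y) + y ⬝ᵥ (M *ᵥ x)
  set s₁ := (-b + -r) / (2 * a) with hs1
  set s₂ := (-b + r) / (2 * a) with hs2
  have hp1 : 0 < s₁ := div_pos_of_neg_of_neg (by linarith) (by linarith)
  have hp2 : s₂ < 0 := div_neg_of_pos_of_neg (by linarith) (by linarith)
  have hprod : s₁ * s₂ * a = c := by
    rw [hs1, hs2]
    field_simp
    linear_combination -hr2
  -- The weights -s₂ and s₁ are positive and cancel the terms in β.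
  have h3 : 0 < (s₁ - s₂) * (quadForm M x - s₁ * s₂ * quadForm M y) := by
    have := add_pos (mul_pos (neg_pos.mpr hp2) h1) (mul_pos hp1 h2)
    linarith
  have h4 : 0 < quadForm M x - s₁ * s₂ * quadForm M y :=
    (mul_pos_iff_of_pos_left (by linarith)).mp h3
  rw [← hprod]
  nlinarith

/-- The strict S-lemma for two quadratic forms. -/
theorem strict_s_lemma (M N : Matrix ι ι ℝ)
    (h : ∀ x, x ≠ 0 → 0 ≤ quadForm N x → 0 < quadForm M x) :
    ∃ α : ℝ, ∀ x, x ≠ 0 → α * quadForm N x < quadForm M x := by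
  classical
  by_cases hpos : ∃ x₀, 0 < quadForm N x₀
  · obtain ⟨x₀, hx₀⟩ := hpos
    -- Half of this margin ε is given away in M', so that a non-strict bound for M' becomes a strict
    -- one for M.
    obtain ⟨ε, hε, hεM⟩ := exists_pos_mul_le_quadForm (M := M) (s := {x | 0 ≤ quadForm N x})
      (isClosed_le continuous_const (continuous_quadForm N))
      (fun x hx c _ => by
        change 0 ≤ quadForm N (c • x)
        rw [quadForm_smul]
        exact mul_nonneg (sq_nonneg c) hx)
      (fun x hx hx0 => h x hx0 hx)
    have hself : ∀ x : ι → ℝ, x ≠ 0 → 0 < x ⬝ᵥ x := fun x hx => by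
      simpa using Matrix.dotProduct_star_self_pos_iff.mpr hx
    set M' := M - (ε / 2) • (1 : Matrix ι ι ℝ) with hM'
    have hM'x : ∀ x, quadForm M' x = quadForm M x - ε / 2 * (x ⬝ᵥ x) := fun x => by
      rw [hM', quadForm_sub, quadForm_smul_left]
      simp [quadForm]
    have h' : ∀ x, x ≠ 0 → 0 ≤ quadForm N x → 0 < quadForm M' x := fun x hx hNx => by
      rw [hM'x]
      nlinarith [hεM x hNx, mul_pos hε (hself x hx)]
    have hne : ∀ x, 0 < quadForm N x → x ≠ 0 := by
      rintro x hx rfl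
      simp at hx
    -- Vectors with N > 0 bound the multiplier from above, those with N < 0 from below; the infimum
    -- of the upper bounds meets both requirements.
    set A := (fun x => quadForm M' x / quadForm N x) '' {x | 0 < quadForm N x} with hA
    have hAne : A.Nonempty := ⟨_, x₀, hx₀, rfl⟩
    have hAbdd : BddBelow A := by
      refine ⟨0, ?_⟩
      rintro _ ⟨x, hx, rfl⟩
      exact div_nonneg (h' x (hne x hx) (le_of_lt hx)).le (le_of_lt hx)
    refine ⟨sInf A, fun x hx => ?_⟩
    have key : sInf A * quadForm N x ≤ quadForm M' x := by
      rcases lt_trichotomy (quadForm N x) 0 with hn | hn | hn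
      · have : quadForm M' x / quadForm N x ≤ sInf A := by
          refine le_csInf hAne ?_
          rintro _ ⟨z, hz, rfl⟩
          have hz' : 0 < quadForm N z := hz
          have := quadForm_mul_lt_of_neg_of_pos h' hz hn
          change quadForm M' x / quadForm N x ≤ quadForm M' z / quadForm N z
          rw [div_le_iff_of_neg hn, div_mul_eq_mul_div, div_le_iff₀ hz']
          linarith
        rwa [div_le_iff_of_neg hn] at this
      · rw [hn, mul_zero]
        exact (h' x hx hn.ge).le
      · exact (le_div_iff₀ hn).mp (csInf_le hAbdd ⟨x, hn, rfl⟩)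
    refine key.trans_lt ?_
    rw [hM'x]
    nlinarith [mul_pos hε (hself x hx)]
  -- Without a point where N > 0 there is no upper bound, and a large natural number serves as
  -- multiplier. The unit vectors violating multiplier k form nested compact sets because N ≤ 0; a
  -- common point would violate all multipliers.
  · push Not at hpos
    by_contra! hcon
    let K : ℕ → Set (ι → ℝ) := fun k =>
      {x | x ⬝ᵥ x = 1} ∩ {x | quadForm M x ≤ k * quadForm N x}
    have hclosed : ∀ k : ℕ, IsClosed {x | quadForm M x ≤ k * quadForm N x} := fun k =>
      isClosed_le (continuous_quadForm M) (continuous_const.mul (continuous_quadForm N))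
    obtain ⟨x, hx⟩ := IsCompact.nonempty_iInter_of_sequence_nonempty_isCompact_isClosed K
      (fun k x hx => ⟨hx.1, by
        have h1 : quadForm M x ≤ ((k + 1 : ℕ) : ℝ) * quadForm N x := hx.2
        have h2 := hpos x
        push_cast at h1
        change quadForm M x ≤ k * quadForm N x
        linarith⟩)
      (fun k => by
        obtain ⟨x, hx0, hx⟩ := hcon k
        obtain ⟨c, hc, hc1⟩ := exists_pos_smul_dotProduct_self_eq_one hx0
        refine ⟨c • x, hc1, ?_⟩
        change quadForm M (c • x) ≤ k * quadForm N (c • x)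
        rw [quadForm_smul, quadForm_smul]
        nlinarith [mul_le_mul_of_nonneg_left hx (sq_nonneg c)])
      (isCompact_dotProduct_self_eq_one.inter_right (by exact_mod_cast hclosed 0))
      (fun k => (isCompact_dotProduct_self_eq_one.inter_right (hclosed k)).isClosed)
    rw [Set.mem_iInter] at hx
    have hx0 : x ≠ 0 := by
      rintro rfl
      simpa using (hx 0).1
    have hneg : quadForm N x < 0 := by
      by_contra hge
      have h1 : quadForm M x ≤ ((0 : ℕ) : ℝ) * quadForm N x := (hx 0).2
      have h2 := h x hx0 (not_lt.mp hge)
      simp only [Nat.cast_zero, zero_mul] at h1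
      linarith
    obtain ⟨k, hk⟩ := exists_nat_gt (quadForm M x / quadForm N x)
    have h1 : quadForm M x ≤ k * quadForm N x := (hx k).2
    rw [div_lt_iff_of_neg hneg] at hk
    linarith

end QuadraticForms

/-! ### Schur complements and interpolation for quadratic matrix inequalities -/

section BlockForms

variable {ι κ : Type} [Fintype ι] [Fintype κ] [DecidableEq κ]

/-- Completion of the square. -/
theorem quadForm_fromBlocks (A : Matrix ι ι ℝ) (B : Matrix ι κ ℝ) {D : Matrix κ κ ℝ}
    (hD : D.IsSymm) (hDu : IsUnit D) (x : ι → ℝ) (z : κ → ℝ) :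
    quadForm (fromBlocks A B Bᵀ D) (Sum.elim x z) =
      quadForm D ((D⁻¹ * Bᵀ) *ᵥ x + z) + quadForm (A - B * D⁻¹ * Bᵀ) x := by
  let : Invertible D := hDu.invertible
  have := schur_complement_eq₂₂ A B (D := D) x z (by rw [IsHermitian, conjTranspose_eq_transpose_of_trivial, hD.eq])
  simpa only [quadForm, dotProduct_mulVec, star_trivial, conjTranspose_eq_transpose_of_trivial]
    using this

theorem posDef_fromBlocks₂₂ (A : Matrix ι ι ℝ) (B : Matrix ι κ ℝ) {D : Matrix κ κ ℝ}
    (hD : D.PosDef) :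
    (fromBlocks A B Bᵀ D).PosDef ↔ (A - B * D⁻¹ * Bᵀ).PosDef := by
  have hDs : D.IsSymm := (posDef_iff_quadForm.mp hD).1
  have hinv : (D⁻¹)ᵀ = D⁻¹ := by rw [transpose_nonsing_inv, hDs.eq]
  have hB : (B * D⁻¹ * Bᵀ)ᵀ = B * D⁻¹ * Bᵀ := by
    simp [transpose_mul, hinv, Matrix.mul_assoc]
  rw [posDef_iff_quadForm, posDef_iff_quadForm]
  constructor
  · rintro ⟨hs, hpos⟩
    have hA : A.IsSymm := (isSymm_fromBlocks_iff.mp hs).1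
    refine ⟨by rw [IsSymm, transpose_sub, hB, hA.eq], fun x hx => ?_⟩
    -- This second component annihilates the completed square.
    have := hpos (Sum.elim x (-((D⁻¹ * Bᵀ) *ᵥ x))) fun h0 => hx <| by
      funext i
      exact congrFun h0 (Sum.inl i)
    rwa [quadForm_fromBlocks A B hDs hD.isUnit, add_neg_cancel, quadForm_zero, zero_add] at this
  · rintro ⟨hs, hpos⟩
    have hA : A.IsSymm := by
      have h := hs.eq
      rwa [transpose_sub, hB, sub_left_inj] at h
    refine ⟨isSymm_fromBlocks_iff.mpr ⟨hA, rfl, transpose_transpose B, hDs⟩, fun x hx => ?_⟩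
    rw [← Sum.elim_comp_inl_inr x, quadForm_fromBlocks A B hDs hD.isUnit]
    have hnn : ∀ z, 0 ≤ quadForm D z := (posSemidef_iff_quadForm.mp hD.posSemidef).2
    rcases eq_or_ne (x ∘ Sum.inl) 0 with h0 | h0
    · rw [h0, mulVec_zero, zero_add, quadForm_zero, add_zero]
      refine (posDef_iff_quadForm.mp hD).2 _ fun h1 => hx ?_
      rw [← Sum.elim_comp_inl_inr x, h0, h1]
      exact Sum.elim_zero_zero
    · exact add_pos_of_nonneg_of_pos (hnn _) (hpos _ h0)

/-- A discrete-time Lyapunov inequality for `A` dualizes to one for `Aᵀ`. -/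
theorem posDef_sub_conj_inv_iff (A Φ : Matrix κ κ ℝ) (hΦ : Φ.PosDef) :
    (Φ - A * Φ * Aᵀ).PosDef ↔ (Φ⁻¹ - Aᵀ * Φ⁻¹ * A).PosDef := by
  -- Both inequalities are Schur complements of one block matrix with diagonal blocks Φ and Φ⁻¹,
  -- taken with respect to different blocks.
  have h1 := posDef_fromBlocks₂₂ Φ⁻¹ Aᵀ hΦ
  have h2 := posDef_fromBlocks₂₂ Φ A hΦ.inv
  rw [transpose_transpose] at h1
  rw [nonsing_inv_nonsing_inv _ ((isUnit_iff_isUnit_det _).mp hΦ.isUnit)] at h2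
  rw [← h1, ← h2]
  have hswap : fromBlocks Φ A Aᵀ Φ⁻¹ =
      (fromBlocks Φ⁻¹ Aᵀ A Φ).submatrix Sum.swap Sum.swap := by
    rw [fromBlocks_submatrix_sum_swap_sum_swap]
  constructor
  · intro h
    have := h.submatrix (e := Sum.swap) (Equiv.sumComm κ κ).injective
    rwa [fromBlocks_submatrix_sum_swap_sum_swap] at this
  · intro h
    rw [hswap]
    exact h.submatrix (Equiv.sumComm κ κ).injective

-- Cauchy–Schwarz for a possibly degenerate form: s ↦ W(x + s y) is nonnegative, so its discriminant
-- is not positive.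
omit [Fintype κ] [DecidableEq κ] in
theorem sq_dotProduct_mulVec_le {W : Matrix ι ι ℝ} (hW : W.PosSemidef) (x y : ι → ℝ) :
    (y ⬝ᵥ (W *ᵥ x)) ^ 2 ≤ quadForm W x * quadForm W y := by
  obtain ⟨hs, hnn⟩ := posSemidef_iff_quadForm.mp hW
  have hsym : x ⬝ᵥ (W *ᵥ y) = y ⬝ᵥ (W *ᵥ x) := by
    rw [dotProduct_mulVec, ← mulVec_transpose, hs.eq, dotProduct_comm]
  have := discrim_le_zero (a := quadForm W y) (b := 2 * (y ⬝ᵥ (W *ᵥ x)))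
    (c := quadForm W x) fun s => by
      have := hnn (x + s • y)
      rw [quadForm_add_smul, hsym] at this
      linarith
  rw [discrim] at this
  linarith

/-- The solution set of a feasible quadratic matrix inequality with negative definite lower right
block interpolates every pair of vectors that satisfies the underlying scalar inequality. -/
theorem exists_mulVec_eq_and_qmi (A : Matrix ι ι ℝ) (B : Matrix ι κ ℝ) {D : Matrix κ κ ℝ}
    (hA : A.IsSymm) (hD : (-D).PosDef)
    (hfeas : ∃ Z : Matrix κ ι ℝ, ∀ x, 0 ≤ quadForm (fromBlocks A B Bᵀ D) (Sum.elim x (Z *ᵥ x)))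
    {x : ι → ℝ} {z : κ → ℝ} (hxz : 0 ≤ quadForm (fromBlocks A B Bᵀ D) (Sum.elim x z)) :
    ∃ Z : Matrix κ ι ℝ, Z *ᵥ x = z ∧
      ∀ a, 0 ≤ quadForm (fromBlocks A B Bᵀ D) (Sum.elim a (Z *ᵥ a)) := by
  have hDs : D.IsSymm := by
    have := (posDef_iff_quadForm.mp hD).1
    rwa [IsSymm, transpose_neg, neg_inj] at this
  have hDu : IsUnit D := by simpa using hD.isUnit.neg
  have hneg : ∀ d, quadForm D d ≤ 0 := fun d => by
    have := (posSemidef_iff_quadForm.mp hD.posSemidef).2 d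
    rw [quadForm_neg] at this
    linarith
  have hneg0 : ∀ d, 0 ≤ quadForm D d → d = 0 := fun d hd => by
    by_contra h0
    have := (posDef_iff_quadForm.mp hD).2 d h0
    rw [quadForm_neg] at this
    linarith
  set W := A - B * D⁻¹ * Bᵀ with hWdef
  set Y := D⁻¹ * Bᵀ with hY
  have hform : ∀ a b, quadForm (fromBlocks A B Bᵀ D) (Sum.elim a b) =
      quadForm D (Y *ᵥ a + b) + quadForm W a := quadForm_fromBlocks A B hDs hDu
  simp only [hform] at *
  have hWs : W.IsSymm := by
    rw [IsSymm, hWdef, transpose_sub, hA.eq]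
    simp [transpose_mul, transpose_nonsing_inv, hDs.eq, Matrix.mul_assoc]
  -- Feasibility is what gives W ≥ 0: the completed square contributes a nonpositive term.
  have hW : W.PosSemidef := posSemidef_iff_quadForm.mpr ⟨hWs, fun a => by
    obtain ⟨Z, hZ⟩ := hfeas
    linarith [hZ a, hneg (Y *ᵥ a + Z *ᵥ a)]⟩
  have hWnn := (posSemidef_iff_quadForm.mp hW).2
  set d := Y *ᵥ x + z with hd
  rcases (hWnn x).eq_or_lt with h0 | hc
  -- If W vanishes at x, the pair must lie on the graph of the centre -Y, which is itself a
  -- solution.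
  · have hd0 : d = 0 := hneg0 d (by linarith)
    refine ⟨-Y, ?_, fun a => ?_⟩
    · rw [neg_mulVec]
      exact neg_eq_of_add_eq_zero_right hd0
    · simpa [neg_mulVec] using hWnn a
  · set c := quadForm W x with hcdef
    -- Otherwise the centre is corrected by the rank-one matrix d (W x)ᵀ / c. It sends x to z, and
    -- Cauchy–Schwarz for W bounds its effect on every other vector.
    have hmul : ∀ a, (-Y + vecMulVec d (c⁻¹ • (W *ᵥ x))) *ᵥ a =
        -(Y *ᵥ a) + (c⁻¹ * (a ⬝ᵥ (W *ᵥ x))) • d := fun a => by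
      rw [add_mulVec, neg_mulVec, vecMulVec_mulVec, smul_dotProduct, dotProduct_comm a]
      ext i
      simp [mul_comm]
    refine ⟨-Y + vecMulVec d (c⁻¹ • (W *ᵥ x)), ?_, fun a => ?_⟩
    · rw [hmul]
      change _ + (c⁻¹ * c) • d = z
      rw [inv_mul_cancel₀ hc.ne', one_smul, hd]
      abel
    · rw [hmul, add_neg_cancel_left, quadForm_smul]
      have hcs := sq_dotProduct_mulVec_le hW x a
      set e := a ⬝ᵥ (W *ᵥ x)
      have h1 : (c⁻¹ * e) ^ 2 * c ≤ quadForm W a := by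
        have : (c⁻¹ * e) ^ 2 * c = e ^ 2 / c := by field_simp
        rw [this, div_le_iff₀ hc]
        linarith
      nlinarith [mul_nonneg (sq_nonneg (c⁻¹ * e)) hxz]

end BlockForms

/-! ### Discrete-time Lyapunov stability -/

section Dynamics

open Filter Topology

variable {κ : Type} [Fintype κ]

/-- Lyapunov's theorem for discrete-time linear systems. -/
theorem tendsto_zero_of_lyapunov {A Ψ : Matrix κ κ ℝ} (hΨ : Ψ.PosSemidef)
    (h : (Ψ - Aᵀ * Ψ * A).PosDef) {x : ℕ → κ → ℝ} (hx : ∀ t, x (t + 1) = A *ᵥ x t) :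
    Tendsto x atTop (𝓝 0) := by
  have hΨnn := (posSemidef_iff_quadForm.mp hΨ).2
  obtain ⟨ε, hε, hle⟩ := exists_pos_mul_le_quadForm (s := Set.univ) isClosed_univ
    (fun _ _ _ _ => Set.mem_univ _) fun y _ => (posDef_iff_quadForm.mp h).2 y
  have hstep : ∀ t, ε * (x t ⬝ᵥ x t) ≤ quadForm Ψ (x t) - quadForm Ψ (x (t + 1)) := fun t => by
    have := hle (x t) (Set.mem_univ _)
    rwa [quadForm_sub, quadForm_conj, ← hx] at this
  have hself : ∀ t, 0 ≤ x t ⬝ᵥ x t := fun t => Finset.sum_nonneg fun i _ => mul_self_nonneg _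
  have hanti : Antitone fun t => quadForm Ψ (x t) := antitone_nat_of_succ_le fun t => by
    nlinarith [hstep t, mul_nonneg hε.le (hself t)]
  -- The values of the Ψ-form decrease and are bounded below, so their decrements, which dominate
  -- ε|x(t)|², tend to zero.
  have hlim := tendsto_atTop_ciInf hanti ⟨0, by rintro _ ⟨t, rfl⟩; exact hΨnn _⟩
  have hdiff : Tendsto (fun t => ε⁻¹ * (quadForm Ψ (x t) - quadForm Ψ (x (t + 1)))) atTop
      (𝓝 0) := by
    simpa using (hlim.sub (hlim.comp (tendsto_add_atTop_nat 1))).const_mul ε⁻¹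
  have hsq : Tendsto (fun t => x t ⬝ᵥ x t) atTop (𝓝 0) :=
    squeeze_zero hself (fun t => by
      rw [le_inv_mul_iff₀ hε]
      exact hstep t) hdiff
  rw [tendsto_pi_nhds]
  intro i
  have hi : Tendsto (fun t => x t i ^ 2) atTop (𝓝 0) :=
    squeeze_zero (fun t => sq_nonneg _) (fun t => by
      rw [sq]
      exact Finset.single_le_sum (f := fun i => x t i * x t i) (fun i _ => mul_self_nonneg _)
        (Finset.mem_univ i)) hsq
  have := (Real.continuous_sqrt.tendsto 0).comp hi
  rw [Real.sqrt_zero] at this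
  change Tendsto (fun t => x t i) atTop (𝓝 0)
  rw [tendsto_zero_iff_abs_tendsto_zero]
  simpa [Function.comp_def, Real.sqrt_sq_eq_abs] using this

end Dynamics

/-! ### Quadratic difference forms as forms on windows -/

section ShiftForms

variable {ι : Type} [Fintype ι] {n : ℕ}

/-- The stacked vector `col(w(t), …, w(t + n - 1))`. -/
def window (n : ℕ) (w : ℕ → ι → ℝ) (t : ℕ) : Fin n × ι → ℝ := fun j => w (t + j.1) j.2

theorem quadForm_eq_sum {κ : Type} [Fintype κ] (M : Matrix κ κ ℝ) (x : κ → ℝ) :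
    quadForm M x = ∑ i, ∑ j, x i * (M i j * x j) := by
  simp [quadForm, dotProduct, mulVec, Finset.mul_sum]

theorem QDF_eq_quadForm (Φ : Matrix (Fin n × ι) (Fin n × ι) ℝ) (w : ℕ → ι → ℝ) (t : ℕ) :
    QDF Φ w t = quadForm Φ (window n w t) := by
  simp only [QDF, quadForm_eq_sum, Fintype.sum_prod_type, window, dotProduct, mulVec, of_apply,
    Finset.mul_sum]
  exact Finset.sum_congr rfl fun k _ => Finset.sum_comm

theorem quadForm_nablaMat (Φ : Matrix (Fin n × ι) (Fin n × ι) ℝ) (z : Fin (n + 1) × ι → ℝ) :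
    quadForm (nablaMat Φ) z =
      quadForm Φ (fun j => z (j.1.succ, j.2)) - quadForm Φ (fun j => z (j.1.castSucc, j.2)) := by
  rw [nablaMat, quadForm_sub]
  congr 1
  · simp [quadForm_eq_sum, Fintype.sum_prod_type, Fin.sum_univ_succ]
  · simp [quadForm_eq_sum, Fintype.sum_prod_type, Fin.sum_univ_castSucc]

omit [Fintype ι] in
theorem isSymm_nablaMat {Φ : Matrix (Fin n × ι) (Fin n × ι) ℝ} (h : Φ.IsSymm) :
    (nablaMat Φ).IsSymm := by
  rw [nablaMat, IsSymm, transpose_sub]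
  congr 1
  · ext ⟨k, a⟩ ⟨l, b⟩
    induction k using Fin.cases <;> induction l using Fin.cases <;> simp [h.apply]
  · ext ⟨k, a⟩ ⟨l, b⟩
    induction k using Fin.lastCases <;> induction l using Fin.lastCases <;> simp [h.apply]

/-- The two zero paddings drop the first and the last sample of the window of length n + 1, leaving
the windows at t + 1 and t. -/
theorem QDF_nablaMat (Ψ : Matrix (Fin n × ι) (Fin n × ι) ℝ) (w : ℕ → ι → ℝ) (t : ℕ) :
    QDF (nablaMat Ψ) w t =
      quadForm Ψ (window n w (t + 1)) - quadForm Ψ (window n w t) := by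
  rw [QDF_eq_quadForm, quadForm_nablaMat]
  simp only [window, Fin.val_succ, Fin.val_castSucc]
  congr 3
  funext j
  simp only [window]
  congr 1
  omega

end ShiftForms

/-! ### Companion form of the closed loop and Schur form of the LMI -/

section ClosedLoop

variable {m p L : ℕ}

/-- The companion matrix `[J; -C; -R]` of the closed loop. -/
def stateMat (C : Matrix (Fin m) (LIdx m p L) ℝ) (R : Matrix (Fin p) (LIdx m p L) ℝ) :
    Matrix (LIdx m p L) (LIdx m p L) ℝ :=
  Matrix.of fun x j => closedLoopMat C R (x.1.succ, x.2) j

theorem stateMat_apply_of_lt (C : Matrix (Fin m) (LIdx m p L) ℝ)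
    (R : Matrix (Fin p) (LIdx m p L) ℝ) {k : Fin L} (hk : (k : ℕ) + 1 < L) (c : WIdx m p)
    (j : LIdx m p L) :
    stateMat C R (k, c) j = (1 : Matrix (LIdx m p L) (LIdx m p L) ℝ) (⟨k + 1, hk⟩, c) j := by
  have : k.succ = Fin.castSucc ⟨k + 1, hk⟩ := rfl
  simp only [stateMat, closedLoopMat, of_apply, this, Fin.lastCases_castSucc]

theorem stateMat_apply_of_eq (C : Matrix (Fin m) (LIdx m p L) ℝ)
    (R : Matrix (Fin p) (LIdx m p L) ℝ) {k : Fin L} (hk : (k : ℕ) + 1 = L) (c : WIdx m p)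
    (j : LIdx m p L) :
    stateMat C R (k, c) j = Sum.elim (fun a => - C a j) (fun b => - R b j) c := by
  have : k.succ = Fin.last L := Fin.ext hk
  simp only [stateMat, closedLoopMat, of_apply, this, Fin.lastCases_last]

/-- The first L blocks of `closedLoopMat C R` form the identity and the last L blocks form the
companion matrix, so the inequality is the classical Lyapunov one. -/
theorem lyapunovQMI_iff {Ψ : Matrix (LIdx m p L) (LIdx m p L) ℝ} (hΨ : Ψ.IsSymm)
    (C : Matrix (Fin m) (LIdx m p L) ℝ) (R : Matrix (Fin p) (LIdx m p L) ℝ) :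
    LyapunovQMI Ψ C R ↔ (Ψ - (stateMat C R)ᵀ * Ψ * stateMat C R).PosDef := by
  rw [LyapunovQMI, posDef_iff_quadForm, posDef_iff_quadForm]
  have h1 : (-((closedLoopMat C R)ᵀ * nablaMat Ψ * closedLoopMat C R)).IsSymm :=
    (isSymm_conj _ (isSymm_nablaMat hΨ)).neg
  have h2 : (Ψ - (stateMat C R)ᵀ * Ψ * stateMat C R).IsSymm := hΨ.sub (isSymm_conj _ hΨ)
  have h3 : ∀ x, quadForm (-((closedLoopMat C R)ᵀ * nablaMat Ψ * closedLoopMat C R)) x =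
      quadForm (Ψ - (stateMat C R)ᵀ * Ψ * stateMat C R) x := fun x => by
    rw [quadForm_neg, quadForm_conj, quadForm_nablaMat, quadForm_sub, quadForm_conj, neg_sub]
    congr 2
    funext j
    have : closedLoopMat C R (j.1.castSucc, j.2) =
        (1 : Matrix (LIdx m p L) (LIdx m p L) ℝ) j := by
      funext i
      simp [closedLoopMat]
    change closedLoopMat C R (j.1.castSucc, j.2) ⬝ᵥ x = x j
    rw [this]
    exact congrFun (one_mulVec x) j
  simp only [h1, h2, h3]

/-- This is the change of variables that makes the product of controller and Lyapunov matrix linear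
in the new unknown. -/
theorem stackJD_mul (Φ : Matrix (LIdx m p L) (LIdx m p L) ℝ)
    (D : Matrix (Fin m) (LIdx m p L) ℝ) :
    stackJD Φ (D * Φ) = stackJD 1 D * Φ := by
  ext ⟨k, c⟩ j
  rw [mul_apply]
  simp only [stackJD, of_apply]
  split_ifs with h
  · rw [Matrix.mul_one, mul_apply]
  · cases c <;> simp [mul_apply]

theorem stackJD_smul (r : ℝ) (Φ : Matrix (LIdx m p L) (LIdx m p L) ℝ)
    (D : Matrix (Fin m) (LIdx m p L) ℝ) :
    stackJD (r • Φ) (r • D) = r • stackJD Φ D := by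
  ext ⟨k, c⟩ j
  rw [Matrix.smul_apply]
  simp only [stackJD, of_apply]
  split_ifs with h
  · simp
  · cases c <;> simp

/-- Separates the part fixed by the shift and the controller from the unknown R, which enters only
the last p rows. -/
theorem stateMat_eq (C : Matrix (Fin m) (LIdx m p L) ℝ) (R : Matrix (Fin p) (LIdx m p L) ℝ) :
    stateMat C R = stackJD 1 (-C) - (selLast m p L)ᵀ * R := by
  ext ⟨k, c⟩ j
  rw [Matrix.sub_apply, mul_apply]
  by_cases h : (k : ℕ) + 1 < L
  · have h' : (k : ℕ) < L - 1 := by omega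
    rw [stateMat_apply_of_lt C R h]
    simp [stackJD, shiftJ, selLast, h', h.ne, one_apply, Prod.ext_iff, Fin.ext_iff,
      @eq_comm _ (j.1 : ℕ), @eq_comm _ j.2]
  · have h' : ¬ (k : ℕ) < L - 1 := by omega
    have hL : (k : ℕ) + 1 = L := by omega
    rw [stateMat_apply_of_eq C R hL]
    cases c <;> simp [stackJD, selLast, h', hL]

theorem stateMat_mul (Φ : Matrix (LIdx m p L) (LIdx m p L) ℝ)
    (C : Matrix (Fin m) (LIdx m p L) ℝ) (R : Matrix (Fin p) (LIdx m p L) ℝ) :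
    stateMat C R * Φ = stackJD Φ (-C * Φ) - (Rᵀ * selLast m p L)ᵀ * Φ := by
  rw [stateMat_eq, Matrix.sub_mul, stackJD_mul, transpose_mul, transpose_transpose]

/-- The matrix `[Φ - X Φ⁻¹ Xᵀ, X; Xᵀ, -Φ]`, the Schur complement of the LMI matrix. -/
noncomputable def schurMat {κ : Type} [Fintype κ] [DecidableEq κ] (Φ X : Matrix κ κ ℝ) :
    Matrix (κ ⊕ κ) (κ ⊕ κ) ℝ :=
  fromBlocks (Φ - X * Φ⁻¹ * Xᵀ) X Xᵀ (-Φ)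

theorem isSymm_schurMat {κ : Type} [Fintype κ] [DecidableEq κ] {Φ : Matrix κ κ ℝ}
    (hΦ : Φ.IsSymm) (X : Matrix κ κ ℝ) : (schurMat Φ X).IsSymm := by
  refine isSymm_fromBlocks_iff.mpr ⟨?_, rfl, transpose_transpose X, hΦ.neg⟩
  rw [IsSymm, transpose_sub, hΦ.eq]
  simp [transpose_mul, transpose_nonsing_inv, hΦ.eq, Matrix.mul_assoc]

/-- Expand (X - ZᵀΦ)Φ⁻¹(X - ZᵀΦ)ᵀ: the result is quadratic in Z with leading term ZᵀΦZ. -/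
theorem qmiMat_schurMat {κ : Type} [Fintype κ] [DecidableEq κ] {Φ : Matrix κ κ ℝ}
    (hΦ : Φ.PosDef) {A X Z : Matrix κ κ ℝ} (hA : A * Φ = X - Zᵀ * Φ) :
    qmiMat (schurMat Φ X) Z = Φ - A * Φ * Aᵀ := by
  have hu : IsUnit Φ.det := (isUnit_iff_isUnit_det _).mp hΦ.isUnit
  have hs : Φᵀ = Φ := (posDef_iff_quadForm.mp hΦ).1
  have hX : X = (A + Zᵀ) * Φ := by rw [Matrix.add_mul, hA, sub_add_cancel]
  have hXt : Xᵀ = Φ * (Aᵀ + Z) := by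
    rw [hX, transpose_mul, hs, transpose_add, transpose_transpose]
  rw [qmiMat, schurMat, transpose_fromRows, transpose_one, fromCols_mul_fromBlocks,
    fromCols_mul_fromRows, hXt, hX, mul_nonsing_inv_cancel_right _ _ hu]
  noncomm_ring

/-- Eliminating the third diagonal block Φ produces the term XΦ⁻¹Xᵀ; the extra block row of the LMI
exists to keep that term linear. -/
theorem stabilizationLMI_iff {Nbar : Matrix (LIdx m p L ⊕ LIdx m p L) (LIdx m p L ⊕ LIdx m p L) ℝ}
    {Φ : Matrix (LIdx m p L) (LIdx m p L) ℝ} (hΦ : Φ.PosDef)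
    (D : Matrix (Fin m) (LIdx m p L) ℝ) :
    StabilizationLMI Nbar Φ D ↔ (schurMat Φ (stackJD Φ D) - Nbar).PosDef := by
  set X := stackJD Φ D with hX
  have h := posDef_fromBlocks₂₂ (fromBlocks Φ X Xᵀ (-Φ) - Nbar) (fromRows X (0 : Matrix (LIdx m p L) (LIdx m p L) ℝ)) hΦ
  have h1 : fromRows X (0 : Matrix (LIdx m p L) (LIdx m p L) ℝ) * Φ⁻¹ *
      (fromRows X (0 : Matrix (LIdx m p L) (LIdx m p L) ℝ))ᵀ = fromBlocks (X * Φ⁻¹ * Xᵀ) 0 0 0 := by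
    rw [transpose_fromRows, fromRows_mul, fromRows_mul_fromCols]
    simp
  have h2 : fromBlocks Φ X Xᵀ (-Φ) - Nbar - fromBlocks (X * Φ⁻¹ * Xᵀ) 0 0 0 =
      schurMat Φ X - Nbar := by
    rw [sub_right_comm, schurMat]
    congr 1
    ext (i | i) (j | j) <;> simp
  rw [h1, h2] at h
  rw [← h, StabilizationLMI, ← hX]
  have h3 : fromBlocks (fromBlocks Φ X Xᵀ (-Φ)) (fromRows X 0) (fromCols Xᵀ 0) Φ -
      fromBlocks Nbar 0 0 0 =
      fromBlocks (fromBlocks Φ X Xᵀ (-Φ) - Nbar) (fromRows X 0) (fromRows X 0)ᵀ Φ := by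
    rw [transpose_fromRows, transpose_zero, sub_eq_add_neg, fromBlocks_neg, fromBlocks_add]
    simp [sub_eq_add_neg]
  rw [h3]

theorem IOSystem.coeff_mulVec_window (S : IOSystem m p L) (w : ℕ → WIdx m p → ℝ) (t : ℕ) :
    S.coeff *ᵥ window L w t =
      ∑ i : Fin L, S.P i *ᵥ (fun b => w (t + i) (Sum.inr b)) -
        ∑ i : Fin L, S.Q i *ᵥ (fun a => w (t + i) (Sum.inl a)) := by
  ext a
  simp only [IOSystem.coeff, mulVec, dotProduct, window, of_apply, Fintype.sum_prod_type,
    Fintype.sum_sum_type, Sum.elim_inl, Sum.elim_inr, Pi.sub_apply, Finset.sum_apply,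
    Finset.sum_add_distrib, neg_mul, Finset.sum_neg_distrib]
  ring

theorem FBController.coeff_mulVec_window (K : FBController m p L) (w : ℕ → WIdx m p → ℝ) (t : ℕ) :
    K.coeff *ᵥ window L w t =
      ∑ i : Fin L, K.G i *ᵥ (fun a => w (t + i) (Sum.inl a)) -
        ∑ i : Fin L, K.F i *ᵥ (fun b => w (t + i) (Sum.inr b)) := by
  ext a
  simp only [FBController.coeff, mulVec, dotProduct, window, of_apply, Fintype.sum_prod_type,
    Fintype.sum_sum_type, Sum.elim_inl, Sum.elim_inr, Pi.sub_apply, Finset.sum_apply,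
    Finset.sum_add_distrib, neg_mul, Finset.sum_neg_distrib]
  ring

/-- All blocks but the last are shifted; the last is obtained by solving the controller and system
equations for u(t+L) and y(t+L). -/
theorem window_succ_of_mem_closedLoop {S : IOSystem m p L} {K : FBController m p L}
    {w : ℕ → WIdx m p → ℝ} (hw : w ∈ closedLoop S K) (t : ℕ) :
    window L w (t + 1) = stateMat K.coeff S.coeff *ᵥ window L w t := by
  obtain ⟨hS, hK⟩ := hw
  have hS' := hS t
  have hK' := hK t
  ext ⟨k, c⟩
  by_cases h : (k : ℕ) + 1 < L
  · have : stateMat K.coeff S.coeff (k, c) =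
        (1 : Matrix (LIdx m p L) (LIdx m p L) ℝ) (⟨k + 1, h⟩, c) :=
      funext (stateMat_apply_of_lt _ _ h c)
    change _ = stateMat K.coeff S.coeff (k, c) ⬝ᵥ window L w t
    rw [this]
    refine Eq.trans ?_ (congrFun (one_mulVec (window L w t)) _).symm
    simp only [window]
    congr 1
    omega
  · have hkL : (k : ℕ) + 1 = L := by omega
    have hrow : stateMat K.coeff S.coeff (k, c) = _ := funext (stateMat_apply_of_eq _ _ hkL c)
    change _ = stateMat K.coeff S.coeff (k, c) ⬝ᵥ window L w t
    rw [hrow]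
    have ht : t + 1 + (k : ℕ) = t + L := by omega
    simp only [window, ht]
    cases c with
    | inl a =>
      have h1 := congrFun hK' a
      have h2 := congrFun (K.coeff_mulVec_window w t) a
      have h3 : (fun j => - K.coeff a j) ⬝ᵥ window L w t = -(K.coeff *ᵥ window L w t) a :=
        neg_dotProduct _ _
      change w (t + L) (Sum.inl a) = (fun j => - K.coeff a j) ⬝ᵥ window L w t
      rw [h3, h2]
      simp only [Pi.add_apply, Pi.sub_apply] at h1 ⊢
      linarith
    | inr b =>
      have h1 := congrFun hS' b
      have h2 := congrFun (S.coeff_mulVec_window w t) b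
      have h3 : (fun j => - S.coeff b j) ⬝ᵥ window L w t = -(S.coeff *ᵥ window L w t) b :=
        neg_dotProduct _ _
      change w (t + L) (Sum.inr b) = (fun j => - S.coeff b j) ⬝ᵥ window L w t
      rw [h3, h2]
      simp only [Pi.add_apply, Pi.sub_apply, Pi.zero_apply] at h1 ⊢
      linarith

theorem isStableBehavior_of_lyapunovQMI (hL : 0 < L) {Ψ : Matrix (LIdx m p L) (LIdx m p L) ℝ}
    (hΨ : Ψ.PosSemidef) {S : IOSystem m p L} {K : FBController m p L}
    (h : LyapunovQMI Ψ K.coeff S.coeff) : IsStableBehavior (closedLoop S K) := by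
  intro w hw
  have hlim := tendsto_zero_of_lyapunov hΨ
    ((lyapunovQMI_iff (posSemidef_iff_quadForm.mp hΨ).1 _ _).mp h)
    (window_succ_of_mem_closedLoop hw)
  rw [tendsto_pi_nhds] at hlim ⊢
  exact fun c => hlim (⟨0, hL⟩, c)

/-- The increment is minus a positive definite form of the window, so it vanishes for all t only if
every window does; since L > 0, block 0 of the window recovers w(t). -/
theorem isLyapunovQDF_of_lyapunovQMI (hL : 0 < L) {Ψ : Matrix (LIdx m p L) (LIdx m p L) ℝ}
    (hΨ : Ψ.PosSemidef) {S : IOSystem m p L} {K : FBController m p L}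
    (h : LyapunovQMI Ψ K.coeff S.coeff) : IsLyapunovQDF Ψ (closedLoop S K) := by
  obtain ⟨hs, hnn⟩ := posSemidef_iff_quadForm.mp hΨ
  have hpd := (lyapunovQMI_iff hs _ _).mp h
  refine ⟨hs, fun w _ t => by rw [QDF_eq_quadForm]; exact hnn _, fun w hw => ?_⟩
  have hstep : ∀ t, QDF (nablaMat Ψ) w t = - quadForm
      (Ψ - (stateMat K.coeff S.coeff)ᵀ * Ψ * stateMat K.coeff S.coeff) (window L w t) := fun t => by
    rw [QDF_nablaMat, quadForm_sub, quadForm_conj, ← window_succ_of_mem_closedLoop hw, neg_sub]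
  refine ⟨fun t => ?_, fun h0 => ?_, ?_⟩
  · rw [hstep, neg_nonpos]
    exact (posSemidef_iff_quadForm.mp hpd.posSemidef).2 _
  · funext t
    have hw0 : window L w t = 0 := by
      by_contra hne
      have h1 := (posDef_iff_quadForm.mp hpd).2 _ hne
      have h2 := h0 t
      rw [hstep] at h2
      linarith
    funext c
    exact congrFun hw0 (⟨0, hL⟩, c)
  · rintro rfl t
    rw [hstep]
    have : window L (0 : ℕ → WIdx m p → ℝ) t = 0 := rfl
    rw [this, quadForm_zero, neg_zero]

end ClosedLoop

/-! ### Data matrices, compatible systems and the two directions of the equivalence -/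

section DataForms

variable {m p L T : ℕ}

theorem quadForm_sumElim_zero {ι κ : Type} [Fintype ι] [Fintype κ]
    (M : Matrix (ι ⊕ κ) (ι ⊕ κ) ℝ) (z : κ → ℝ) :
    quadForm M (Sum.elim 0 z) = quadForm M.toBlocks₂₂ z := by
  simp [quadForm_eq_sum, toBlocks₂₂]

theorem vecMul_injective_of_rank_eq_card {ι κ : Type} [Fintype ι] [Fintype κ]
    {H : Matrix ι κ ℝ} (h : H.rank = Fintype.card ι) : Function.Injective H.vecMul := by
  rw [vecMul_injective_iff, linearIndependent_iff_card_eq_finrank_span, ← h,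
    rank_eq_finrank_span_row, Set.finrank]

/-- For z = Rᵀa the second component is Vᵀa with V the residual of R on the data, which links the
inequality on R to the one on the noise. -/
theorem quadForm_dataN (hLT : L ≤ T)
    (Pi : Matrix (Fin p ⊕ Fin (T - L + 1)) (Fin p ⊕ Fin (T - L + 1)) ℝ)
    (u : Fin (T + 1) → Fin m → ℝ) (y : Fin (T + 1) → Fin p → ℝ)
    (a : Fin p → ℝ) (z : LIdx m p L → ℝ) :
    quadForm (dataN hLT Pi u y) (Sum.elim a z) =
      quadForm Pi (Sum.elim a ((hankel2 hLT y)ᵀ *ᵥ a + (hankel1 hLT u y)ᵀ *ᵥ z)) := by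
  have h := quadForm_conj (fromBlocks 1 (hankel2 hLT y) 0 (hankel1 hLT u y))ᵀ Pi (Sum.elim a z)
  rw [transpose_transpose] at h
  rw [dataN, h, fromBlocks_transpose, fromBlocks_mulVec]
  simp [Function.comp_def]

theorem quadForm_dataNbar (hLT : L ≤ T)
    (Pi : Matrix (Fin p ⊕ Fin (T - L + 1)) (Fin p ⊕ Fin (T - L + 1)) ℝ)
    (u : Fin (T + 1) → Fin m → ℝ) (y : Fin (T + 1) → Fin p → ℝ)
    (x z : LIdx m p L → ℝ) :
    quadForm (dataNbar hLT Pi u y) (Sum.elim x z) =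
      quadForm (dataN hLT Pi u y) (Sum.elim (selLast m p L *ᵥ x) z) := by
  rw [dataNbar, quadForm_conj, fromBlocks_mulVec]
  simp [Function.comp_def]

variable {hLT : L ≤ T} {Pi : Matrix (Fin p ⊕ Fin (T - L + 1)) (Fin p ⊕ Fin (T - L + 1)) ℝ}
  {u : Fin (T + 1) → Fin m → ℝ} {y : Fin (T + 1) → Fin p → ℝ}

theorem isSymm_dataN (hPi : Pi.IsSymm) : (dataN hLT Pi u y).IsSymm := by
  have h := isSymm_conj (fromBlocks 1 (hankel2 hLT y) 0 (hankel1 hLT u y))ᵀ hPi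
  rwa [transpose_transpose] at h

theorem isSymm_dataNbar (hPi : Pi.IsSymm) : (dataNbar hLT Pi u y).IsSymm :=
  isSymm_conj _ (isSymm_dataN hPi)

theorem dataQMI_iff (hPi : Pi.IsSymm) (R : Matrix (Fin p) (LIdx m p L) ℝ) :
    DataQMI (dataN hLT Pi u y) R ↔
      ∀ a, 0 ≤ quadForm (dataN hLT Pi u y) (Sum.elim a (Rᵀ *ᵥ a)) :=
  qmiMat_posSemidef_iff (isSymm_dataN hPi)

/-- The block is H₁Π₂₂H₁ᵀ, and full row rank makes H₁ᵀ injective. Both the interpolation and the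
sign of the multiplier rest on this. -/
theorem posDef_neg_toBlocks₂₂_dataN (hPi : IsNoiseModel Pi)
    (hrank : (hankel1 hLT u y).rank = (m + p) * L) :
    (-(dataN hLT Pi u y).toBlocks₂₂).PosDef := by
  have hinj : Function.Injective (hankel1 hLT u y).vecMul :=
    vecMul_injective_of_rank_eq_card (by simp [hrank, mul_comm])
  refine posDef_iff_quadForm.mpr ⟨?_, fun z hz => ?_⟩
  · have h := isSymm_dataN (hLT := hLT) (u := u) (y := y) hPi.symm
    exact IsSymm.neg (congrArg toBlocks₂₂ h.eq)
  · have hz' : (hankel1 hLT u y)ᵀ *ᵥ z ≠ 0 := by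
      rw [mulVec_transpose]
      exact fun h0 => hz (hinj (h0.trans (zero_vecMul _).symm))
    have h := (posDef_iff_quadForm.mp hPi.neg).2 _ hz'
    rwa [quadForm_neg, ← quadForm_sumElim_zero, quadForm_dataN, mulVec_zero, zero_add,
      quadForm_sumElim_zero, ← quadForm_neg]

theorem Compatible.dataQMI (hPi : Pi.IsSymm) {S : IOSystem m p L}
    (h : Compatible hLT Pi u y S) : DataQMI (dataN hLT Pi u y) S.coeff := by
  obtain ⟨V, hV, hVeq⟩ := h
  rw [dataQMI_iff hPi]
  intro a
  rw [fromCols_mul_fromRows, Matrix.one_mul] at hVeq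
  have := (qmiMat_posSemidef_iff hPi).mp hV a
  rw [quadForm_dataN]
  rwa [← hVeq, add_comm (S.coeff * _), transpose_add, transpose_mul, add_mulVec,
    ← mulVec_mulVec] at this

/-- The true system is compatible, its noise samples being the residual. Hence the data inequality
is feasible. -/
theorem GeneratedData.exists_compatible (h : GeneratedData L Pi u y) :
    ∃ S : IOSystem m p L, Compatible hLT Pi u y S := by
  obtain ⟨S, u', y', v, hS, huy, hV⟩ := h
  refine ⟨S, _, hV, ?_⟩
  rw [fromCols_mul_fromRows, Matrix.one_mul]
  ext a t
  set w : ℕ → WIdx m p → ℝ := fun t => Sum.elim (u' t) (y' t) with hw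
  have h1 : (fun j => hankel1 hLT u y j t) = window L w t := by
    funext ⟨k, c⟩
    have := huy ⟨t + k, by omega⟩
    cases c with
    | inl c => exact (congrFun this.1 c).symm
    | inr c => exact (congrFun this.2 c).symm
  have h2 : hankel2 hLT y a t = y' (t + L) a := (congrFun (huy ⟨t + L, by omega⟩).2 a).symm
  have h3 := congrFun (S.coeff_mulVec_window w t) a
  have h4 := congrFun (hS t) a
  change (S.coeff *ᵥ (fun j => hankel1 hLT u y j t)) a + hankel2 hLT y a t = v t a
  rw [h1, h2, h3]
  simp only [hw, Sum.elim_inl, Sum.elim_inr, _root_.Pi.add_apply, _root_.Pi.sub_apply] at h4 ⊢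
  linarith

theorem stateMat_mul_of_eq {Φ : Matrix (LIdx m p L) (LIdx m p L) ℝ}
    {C D : Matrix (Fin m) (LIdx m p L) ℝ} (hD : -C * Φ = D)
    (R : Matrix (Fin p) (LIdx m p L) ℝ) :
    stateMat C R * Φ = stackJD Φ D - (Rᵀ * selLast m p L)ᵀ * Φ := by
  rw [stateMat_mul, hD]

/-- The Lyapunov inequality of a closed loop in terms of the Schur complement of the LMI. -/
theorem lyapunovQMI_inv_iff {Φ : Matrix (LIdx m p L) (LIdx m p L) ℝ} (hΦ : Φ.PosDef)
    {C D : Matrix (Fin m) (LIdx m p L) ℝ} (hD : -C * Φ = D)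
    (R : Matrix (Fin p) (LIdx m p L) ℝ) :
    LyapunovQMI Φ⁻¹ C R ↔ ∀ x, x ≠ 0 → 0 < quadForm (schurMat Φ (stackJD Φ D))
      (Sum.elim x (Rᵀ *ᵥ (selLast m p L *ᵥ x))) := by
  -- Dualizing puts the unknown into the form Rᵀ, in which the data inequality is written.
  rw [lyapunovQMI_iff (posDef_iff_quadForm.mp hΦ.inv).1, ← posDef_sub_conj_inv_iff _ _ hΦ,
    ← qmiMat_schurMat hΦ (stateMat_mul_of_eq hD R), posDef_iff_quadForm]
  simp only [quadForm_qmiMat, mulVec_mulVec]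
  exact and_iff_right (isSymm_conj _ (isSymm_schurMat (posDef_iff_quadForm.mp hΦ).1 _))

theorem sumElim_ne_zero {ι κ : Type} {x : ι → ℝ} (hx : x ≠ 0) (z : κ → ℝ) :
    Sum.elim x z ≠ 0 := fun h => hx (funext fun i => congrFun h (Sum.inl i))

theorem lyapunovQMI_of_stabilizationLMI (hPi : Pi.IsSymm)
    {D : Matrix (Fin m) (LIdx m p L) ℝ} {Φ : Matrix (LIdx m p L) (LIdx m p L) ℝ}
    (hΦ : Φ.PosDef) (hLMI : StabilizationLMI (dataNbar hLT Pi u y) Φ D)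
    {R : Matrix (Fin p) (LIdx m p L) ℝ} (hR : DataQMI (dataN hLT Pi u y) R) :
    LyapunovQMI Φ⁻¹ (-D * Φ⁻¹) R := by
  have hu : IsUnit Φ.det := (isUnit_iff_isUnit_det _).mp hΦ.isUnit
  have hD : -(-D * Φ⁻¹) * Φ = D := by
    rw [Matrix.neg_mul D, neg_neg, nonsing_inv_mul_cancel_right _ _ hu]
  rw [lyapunovQMI_inv_iff hΦ hD]
  intro x hx
  have h := (posDef_iff_quadForm.mp ((stabilizationLMI_iff hΦ D).mp hLMI)).2 _
    (sumElim_ne_zero hx (Rᵀ *ᵥ (selLast m p L *ᵥ x)))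
  rw [quadForm_sub, quadForm_dataNbar] at h
  linarith [(dataQMI_iff hPi R).mp hR (selLast m p L *ᵥ x)]

/-- Makes the scalar N-inequality on vectors as strong as the matrix inequality on R; this replaces
a matrix S-lemma by the scalar one. -/
theorem exists_dataQMI_mulVec_eq (hPi : IsNoiseModel Pi)
    (hrank : (hankel1 hLT u y).rank = (m + p) * L)
    (hfeas : ∃ R, DataQMI (dataN hLT Pi u y) R) {a : Fin p → ℝ} {z : LIdx m p L → ℝ}
    (haz : 0 ≤ quadForm (dataN hLT Pi u y) (Sum.elim a z)) :
    ∃ R, DataQMI (dataN hLT Pi u y) R ∧ Rᵀ *ᵥ a = z := by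
  simp only [dataQMI_iff hPi.symm] at hfeas ⊢
  have hneg := posDef_neg_toBlocks₂₂_dataN hPi hrank
  have hs := isSymm_dataN (hLT := hLT) (u := u) (y := y) hPi.symm
  have hN : dataN hLT Pi u y = fromBlocks (dataN hLT Pi u y).toBlocks₁₁
      (dataN hLT Pi u y).toBlocks₁₂ (dataN hLT Pi u y).toBlocks₁₂ᵀ
      (dataN hLT Pi u y).toBlocks₂₂ := by
    have h21 : (dataN hLT Pi u y).toBlocks₁₂ᵀ = (dataN hLT Pi u y).toBlocks₂₁ :=
      congrArg toBlocks₂₁ hs.eq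
    rw [h21, fromBlocks_toBlocks]
  have hA : (dataN hLT Pi u y).toBlocks₁₁.IsSymm := congrArg toBlocks₁₁ hs.eq
  obtain ⟨R₀, hR₀⟩ := hfeas
  obtain ⟨Z, hZ, hZq⟩ := exists_mulVec_eq_and_qmi _ (dataN hLT Pi u y).toBlocks₁₂ hA hneg
    ⟨R₀ᵀ, by rwa [← hN]⟩ (by rwa [← hN] : 0 ≤ quadForm _ (Sum.elim a z))
  exact ⟨Zᵀ, by rwa [transpose_transpose, hN], by rwa [transpose_transpose]⟩

/-- Homogeneity of degree one, since XΦ⁻¹Xᵀ scales by r²/r; it allows the multiplier to be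
normalized to 1. -/
theorem schurMat_smul {κ : Type} [Fintype κ] [DecidableEq κ] {r : ℝ} (hr : r ≠ 0)
    (Φ X : Matrix κ κ ℝ) (hΦ : IsUnit Φ.det) :
    schurMat (r • Φ) (r • X) = r • schurMat Φ X := by
  let : Invertible r := invertibleOfNonzero hr
  rw [schurMat, schurMat, fromBlocks_smul, Matrix.inv_smul _ _ hΦ, transpose_smul]
  simp [smul_sub, smul_smul]

theorem exists_stabilizationLMI (hPi : IsNoiseModel Pi)
    (hrank : (hankel1 hLT u y).rank = (m + p) * L) (hfeas : ∃ R, DataQMI (dataN hLT Pi u y) R)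
    (h : InformativeForQuadraticStabilization hLT Pi u y) :
    ∃ (D : Matrix (Fin m) (LIdx m p L) ℝ) (Φ : Matrix (LIdx m p L) (LIdx m p L) ℝ),
      Φ.PosDef ∧ StabilizationLMI (dataNbar hLT Pi u y) Φ D := by
  obtain ⟨C, Ψ, hΨ, hall⟩ := h
  -- For any one R allowed by the data, Ψ is the sum of the definite matrix Ψ - AᵀΨA and the
  -- semidefinite AᵀΨA.
  have hΨpd : Ψ.PosDef := by
    obtain ⟨R, hR⟩ := hfeas
    have h1 := (lyapunovQMI_iff (posSemidef_iff_quadForm.mp hΨ).1 C R).mp (hall R hR)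
    have h2 := h1.add_posSemidef (hΨ.conjTranspose_mul_mul_same (stateMat C R))
    rwa [conjTranspose_eq_transpose_of_trivial, sub_add_cancel] at h2
  obtain ⟨Φ, hΦ, rfl⟩ : ∃ Φ : Matrix (LIdx m p L) (LIdx m p L) ℝ, Φ.PosDef ∧ Φ⁻¹ = Ψ :=
    ⟨Ψ⁻¹, hΨpd.inv, nonsing_inv_nonsing_inv _ ((isUnit_iff_isUnit_det _).mp hΨpd.isUnit)⟩
  set X := stackJD Φ (-C * Φ) with hX
  obtain ⟨α, hα⟩ := strict_s_lemma (schurMat Φ X) (dataNbar hLT Pi u y) fun v hv hNv => by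
    rw [← Sum.elim_comp_inl_inr v] at hv hNv ⊢
    generalize v ∘ Sum.inl = x at hv hNv ⊢
    generalize v ∘ Sum.inr = z at hv hNv ⊢
    rw [quadForm_dataNbar] at hNv
    obtain ⟨R, hR, rfl⟩ := exists_dataQMI_mulVec_eq hPi hrank hfeas hNv
    refine (lyapunovQMI_inv_iff hΦ rfl R).mp (hall R hR) x ?_
    -- If x = 0, then z = Rᵀ0 = 0 as well, so the pair was not a nonzero vector.
    rintro rfl
    exact hv (by simp)
  -- In dimension zero nothing determines the sign of α, but every matrix is positive definite.
  rcases isEmpty_or_nonempty (LIdx m p L) with hemp | ⟨⟨i⟩⟩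
  · refine ⟨0, 1, PosDef.one, posDef_iff_quadForm.mpr ⟨?_, fun x hx => ?_⟩⟩
    · exact Subsingleton.elim _ _
    · exact (hx (Subsingleton.elim _ _)).elim
  -- On vectors (0, e) both forms are negative, which forces a positive multiplier.
  have hα0 : 0 < α := by
    have he : (_root_.Pi.single i 1 : LIdx m p L → ℝ) ≠ 0 := by simp
    have h1 := hα (Sum.elim 0 (_root_.Pi.single i 1)) fun h0 => he <| by
      funext j
      exact congrFun h0 (Sum.inr j)
    rw [quadForm_dataNbar, mulVec_zero, quadForm_sumElim_zero, quadForm_sumElim_zero, schurMat,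
      toBlocks_fromBlocks₂₂, quadForm_neg] at h1
    have h2 := (posDef_iff_quadForm.mp hΦ).2 _ he
    have h3 := (posDef_iff_quadForm.mp (posDef_neg_toBlocks₂₂_dataN hPi hrank)).2 _ he
    rw [quadForm_neg] at h3
    nlinarith
  have hΦ' : (α⁻¹ • Φ).PosDef := hΦ.smul (inv_pos.mpr hα0)
  have hdet : IsUnit Φ.det := (isUnit_iff_isUnit_det _).mp hΦ.isUnit
  refine ⟨α⁻¹ • (-C * Φ), α⁻¹ • Φ, hΦ', (stabilizationLMI_iff hΦ' _).mpr ?_⟩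
  rw [stackJD_smul, schurMat_smul (inv_ne_zero hα0.ne') _ _ hdet]
  refine posDef_iff_quadForm.mpr ⟨?_, fun v hv => ?_⟩
  · exact ((isSymm_schurMat (posDef_iff_quadForm.mp hΦ).1 _).smul _).sub
      (isSymm_dataNbar hPi.symm)
  · rw [quadForm_sub, quadForm_smul_left, sub_pos, lt_inv_mul_iff₀ hα0]
    exact hα v hv

end DataForms

/-! ### The main theorem -/

theorem mainTheorem1 {m p L T : ℕ} (hL : 0 < L) (hLT : L ≤ T)
    (Pi : Matrix (Fin p ⊕ Fin (T - L + 1)) (Fin p ⊕ Fin (T - L + 1)) ℝ)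
    (hPi : IsNoiseModel Pi)
    (u : Fin (T + 1) → Fin m → ℝ) (y : Fin (T + 1) → Fin p → ℝ)
    (hdata : GeneratedData L Pi u y)
    (hrank : (hankel1 hLT u y).rank = (m + p) * L) :
    (InformativeForQuadraticStabilization hLT Pi u y ↔
      ∃ (D : Matrix (Fin m) (LIdx m p L) ℝ) (Φ : Matrix (LIdx m p L) (LIdx m p L) ℝ),
        Φ.PosDef ∧ StabilizationLMI (dataNbar hLT Pi u y) Φ D) ∧
    ∀ (D : Matrix (Fin m) (LIdx m p L) ℝ) (Φ : Matrix (LIdx m p L) (LIdx m p L) ℝ),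
      Φ.PosDef → StabilizationLMI (dataNbar hLT Pi u y) Φ D →
      ∀ S : IOSystem m p L, Compatible hLT Pi u y S →
        IsStableBehavior (closedLoop S (FBController.ofCoeff (-D * Φ⁻¹))) ∧
        IsLyapunovQDF Φ⁻¹ (closedLoop S (FBController.ofCoeff (-D * Φ⁻¹))) := by
  have hfeas : ∃ R, DataQMI (dataN hLT Pi u y) R := by
    obtain ⟨S, hS⟩ := hdata.exists_compatible (hLT := hLT)
    exact ⟨S.coeff, hS.dataQMI hPi.symm⟩
  refine ⟨⟨exists_stabilizationLMI hPi hrank hfeas, ?_⟩, ?_⟩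
  · rintro ⟨D, Φ, hΦ, hLMI⟩
    exact ⟨-D * Φ⁻¹, Φ⁻¹, hΦ.inv.posSemidef, fun R hR =>
      lyapunovQMI_of_stabilizationLMI hPi.symm hΦ hLMI hR⟩
  · intro D Φ hΦ hLMI S hS
    have h := lyapunovQMI_of_stabilizationLMI hPi.symm hΦ hLMI (hS.dataQMI hPi.symm)
    rw [← FBController.coeff_ofCoeff (-D * Φ⁻¹)] at h
    exact ⟨isStableBehavior_of_lyapunovQMI hL hΦ.inv.posSemidef h,
      isLyapunovQDF_of_lyapunovQMI hL hΦ.inv.posSemidef h⟩
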